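/- A left brace is a set $B$ with two operations $+,\cdot$ such that $(B,+)$ is an abelian group, $(B,\cdot)$ is a group, and $a\cdot(b+c)+a=a\cdot b+a\cdot c$ for all $a,b,c\in B$. Put $\lambda_a(b)=-a+a\cdot b$; this defines an action $\lambda$ of $(B,\cdot)$ on $B$. For $a\in B$ let $\operatorname{St}(a)=\{b\in B:\lambda_b(a)=a\}$ be its stabiliser, let $\mathcal O$ be the set of orbits of $\lambda$, and fix an element $a_i\in i$ for each orbit $i\in\mathcal O$. Let $I\subseteq\mathcal O$ be such that $\bigcup_{i\in I}i$ generates the group $(B,+)$. For each $i\in I$ let $J_i$ be a non-empty set and let $\{K_{i,j}\}_{j\in J_i}$ be a family of subgroups of $(B,\cdot)$ contained in $\operatorname{St}(a_i)$, such that $\bigcap_{i\in I}\bigcap_{j\in J_i}\bigcap_{b\in B}bK_{i,j}b^{-1}=\{1\}$. Let $X=\bigsqcup_{i\in I}\bigsqcup_{j\in J_i}B/K_{i,j}$ be the disjoint union of the sets of left cosets, and let $r:X\times X\to X\times X$ be $$r(x,y)=\bigl(f_x(y),\,f_{f_x(y)}^{-1}(x)\bigr),\qquad f_{b_1K_{i_1,j_1}}(b_2K_{i_2,j_2})=\lambda_{b_1}(a_{i_1})\,b_2K_{i_2,j_2}.$$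 Let $(X',r')$ be built in the same way, with the same $B$ and the same representatives $a_i$, from $I'\subseteq\mathcal O$, non-empty sets $J'_{i'}$ ($i'\in I'$) and subgroups $L_{i',j'}\le\operatorname{St}(a_{i'})$ ($i'\in I'$, $j'\in J'_{i'}$) satisfying the same conditions. **Theorem.** The solutions $(X,r)$ and $(X',r')$ of the Yang–Baxter equation are isomorphic (that is, there is a bijection $F:X\to X'$ with $r'\circ(F\times F)=(F\times F)\circ r$) if and only if there exist an automorphism $\psi$ of the left brace $B$ (a bijection preserving $+$ and $\cdot$), a bijection $\alpha:I\to I'$, bijections $\beta_i:J_i\to J'_{\alpha(i)}$ for each $i\in I$, and elements $z_{i,j}\in B$ for each $i\in I$, $j\in J_i$, such that $$\psi(a_i)=\lambda_{z_{i,j}}(a_{\alpha(i)})\quad\text{and}\quad\psi(K_{i,j})=z_{i,j}\,L_{\alpha(i),\beta_i(j)}\,z_{i,j}^{-1}$$ for all $i\in I$ and $j\in J_i$. -/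

import Mathlib

/-- A left brace: an abelian group `(B, +)` and a group `(B, *)` on the same set with
`a * (b + c) + a = a * b + a * c`. -/
class LeftBrace (B : Type*) extends AddCommGroup B, Group B where
  mul_add_add (a b c : B) : a * (b + c) + a = a * b + a * c

namespace LeftBrace

variable {B : Type*} [LeftBrace B]

/-- The map `lam a b`, usually written `λ_a(b)`. -/
def lam (a b : B) : B := -a + a * b

theorem one_eq_zero : (1 : B) = 0 := by
  have h := mul_add_add (1 : B) 0 0
  simpa using h

theorem add_lam (a b : B) : a + lam a b = a * b := by
  simp [lam]

theorem lam_one (b : B) : lam 1 b = b := by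
  simp [lam, one_eq_zero]

theorem lam_add (a b c : B) : lam a (b + c) = lam a b + lam a c := by
  have h := mul_add_add a b c
  have h' : a * (b + c) = a * b + a * c - a := eq_sub_of_add_eq h
  simp only [lam, h']
  abel

theorem lam_mul (a b c : B) : lam (a * b) c = lam a (lam b c) := by
  have h1 : lam a (b + lam b c) = lam a b + lam a (lam b c) := lam_add a b (lam b c)
  rw [add_lam] at h1
  have h2 : a + lam a (b * c) = a * (b * c) := add_lam a (b * c)
  have h3 : a + lam a b = a * b := add_lam a b
  have h4 : a * b + lam (a * b) c = a * b * c := add_lam (a * b) c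
  have : a * b + lam (a * b) c = a * b + lam a (lam b c) := by
    rw [h4, mul_assoc, ← h2, h1, ← h3, add_assoc]
  exact add_left_cancel this

theorem lam_inv_lam (a b : B) : lam a⁻¹ (lam a b) = b := by
  rw [← lam_mul, inv_mul_cancel, lam_one]

theorem mul_lam_inv (a b : B) : a * lam a⁻¹ b = a + b := by
  rw [← add_lam, ← lam_mul, mul_inv_cancel, lam_one]

theorem lam_inv_self (a b : B) : lam (lam a b)⁻¹ a = (lam a b)⁻¹ * (a * b) := by
  rw [eq_inv_mul_iff_mul_eq, mul_lam_inv, add_comm, add_lam]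

/-- The orbit `{λ_b(a) | b ∈ B}`. -/
def orbit (a : B) : Set B := Set.range fun b : B => lam b a

/-- The stabiliser `St(a) = {b | λ_b(a) = a}`, a subgroup of `(B, *)`. -/
def stab (a : B) : Subgroup B where
  carrier := {b | lam b a = a}
  one_mem' := lam_one a
  mul_mem' := by
    intro b c hb hc
    simp only [Set.mem_ofPred_eq] at hb hc ⊢
    rw [lam_mul, hc, hb]
  inv_mem' := by
    intro b hb
    simp only [Set.mem_ofPred_eq] at hb ⊢
    conv_lhs => rw [← hb]
    exact lam_inv_lam b a

variable (B) in
/-- The set of all orbits of the action `λ` of `(B, *)` on `B`. -/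
def orbits : Set (Set B) := Set.range fun a : B => orbit a

end LeftBrace

/-- The map `r × id` on `X × X × X`. -/
def leftMap {X : Type*} (r : X × X → X × X) : X × X × X → X × X × X :=
  fun p => ((r (p.1, p.2.1)).1, (r (p.1, p.2.1)).2, p.2.2)

/-- The map `id × r` on `X × X × X`. -/
def rightMap {X : Type*} (r : X × X → X × X) : X × X × X → X × X × X :=
  fun p => (p.1, r p.2)

/-- `(X, r)` is a set-theoretic solution of the Yang-Baxter equation. -/
structure IsSolution {X : Type*} (r : X × X → X × X) : Prop where
  nonempty : Nonempty X
  bijective : Function.Bijective r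
  braid : leftMap r ∘ rightMap r ∘ leftMap r = rightMap r ∘ leftMap r ∘ rightMap r

/-- All the maps `f_x` and `g_y` in `r (x, y) = (f_x(y), g_y(x))` are bijective. -/
def IsNondegenerate {X : Type*} (r : X × X → X × X) : Prop :=
  (∀ x, Function.Bijective fun y => (r (x, y)).1) ∧
    ∀ y, Function.Bijective fun x => (r (x, y)).2

/-- `r ∘ r = id`. -/
def IsInvolutive {X : Type*} (r : X × X → X × X) : Prop := r ∘ r = id

/-- `(X, r)` and `(Y, s)` are isomorphic: there is a bijection `F : X → Y` with
`s ∘ (F × F) = (F × F) ∘ r`. -/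
def AreIsomorphic {X Y : Type*} (r : X × X → X × X) (s : Y × Y → Y × Y) : Prop :=
  ∃ F : X → Y, Function.Bijective F ∧
    ∀ x₁ x₂, s (F x₁, F x₂) = Prod.map F F (r (x₁, x₂))

open LeftBrace in
/-- The data from which an involutive solution is built, for a left brace `B` with a chosen
element `a i` of each orbit `i` of the action `λ`. -/
structure InvolutiveDatum (B : Type*) [LeftBrace B] (a : orbits B → B) where
  /-- A set of orbits. -/
  I : Set (orbits B)
  /-- The union of the orbits in `I` generates `(B, +)`. -/
  closure_eq_top : AddSubgroup.closure (⋃ i ∈ I, (i : Set B)) = ⊤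
  /-- The index sets. -/
  J : I → Type*
  nonempty_J : ∀ i, Nonempty (J i)
  /-- A family of subgroups of the stabiliser of `a i` in `(B, *)`. -/
  K : (i : I) → J i → Subgroup B
  K_le_stab : ∀ i j, K i j ≤ stab (a i)
  /-- The intersection of the cores of all `K i j` in `(B, *)` is trivial. -/
  iInf_core : ⨅ i, ⨅ j, (K i j).normalCore = ⊥

namespace InvolutiveDatum

open LeftBrace

variable {B : Type*} [LeftBrace B] {a : orbits B → B} (D : InvolutiveDatum B a)

/-- The disjoint union of the sets of left cosets `B / K i j`. -/
def X : Type _ := Σ i : D.I, Σ j : D.J i, B ⧸ D.K i j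

/-- The left coset `b K i j` as an element of `X`. -/
def coset (b : B) (i : D.I) (j : D.J i) : D.X := ⟨i, j, (b : B ⧸ D.K i j)⟩

/-- The action of `(B, *)` on `X` by left multiplication of cosets. -/
instance : MulAction B D.X :=
  inferInstanceAs (MulAction B (Σ i : D.I, Σ j : D.J i, B ⧸ D.K i j))

theorem smul_coset (c b : B) (i : D.I) (j : D.J i) :
    c • D.coset b i j = D.coset (c * b) i j := rfl

/-- The map `X → B` sending `b K i j` to `λ_b(a i)`. -/
def val : D.X → B
  | ⟨i, j, q⟩ => Quotient.liftOn' q (fun b => lam b (a i)) (by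
      intro b c h
      have hk : lam (b⁻¹ * c) (a i) = a i := D.K_le_stab i j (QuotientGroup.leftRel_apply.mp h)
      change lam b (a i) = lam c (a i)
      conv_lhs => rw [← hk]
      rw [← lam_mul, mul_inv_cancel_left])

theorem val_coset (b : B) (i : D.I) (j : D.J i) : D.val (D.coset b i j) = lam b (a i) := rfl

/-- The permutation `f_x` of `X`, for `x = b₁ K i₁ j₁`, given by
`f_x (b₂ K i₂ j₂) = λ_{b₁}(a i₁) b₂ K i₂ j₂`. -/
def f (x : D.X) : Equiv.Perm D.X := MulAction.toPerm (D.val x)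

theorem f_coset (b₁ : B) (i₁ : D.I) (j₁ : D.J i₁) (b₂ : B) (i₂ : D.I) (j₂ : D.J i₂) :
    D.f (D.coset b₁ i₁ j₁) (D.coset b₂ i₂ j₂) = D.coset (lam b₁ (a i₁) * b₂) i₂ j₂ := rfl

/-- The map `r (x, y) = (f_x(y), f_{f_x(y)}⁻¹(x))`. -/
def r (p : D.X × D.X) : D.X × D.X :=
  (D.f p.1 p.2, (D.f (D.f p.1 p.2)).symm p.1)

theorem r_coset (b₁ : B) (i₁ : D.I) (j₁ : D.J i₁) (b₂ : B) (i₂ : D.I) (j₂ : D.J i₂) :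
    D.r (D.coset b₁ i₁ j₁, D.coset b₂ i₂ j₂) =
      (D.coset (lam b₁ (a i₁) * b₂) i₂ j₂,
        D.coset ((lam (lam b₁ (a i₁) * b₂) (a i₂))⁻¹ * b₁) i₁ j₁) := rfl

theorem val_smul (c : B) (x : D.X) : D.val (c • x) = lam c (D.val x) := by
  obtain ⟨i, j, q⟩ := x
  induction q using Quotient.inductionOn' with
  | h b => exact lam_mul c b (a i)

theorem r_eq (x y : D.X) :
    D.r (x, y) = (D.val x • y, (lam (D.val x) (D.val y))⁻¹ • x) := by
  rw [← D.val_smul]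
  rfl

theorem isInvolutive_r : IsInvolutive D.r := by
  funext ⟨x, y⟩
  change (D.f (D.f x y) ((D.f (D.f x y)).symm x),
    (D.f (D.f (D.f x y) ((D.f (D.f x y)).symm x))).symm (D.f x y)) = (x, y)
  simp

theorem isNondegenerate_r : IsNondegenerate D.r := by
  refine ⟨fun x => (D.f x).bijective, fun y => ?_⟩
  set v := D.val y with hv
  have h : (fun x => (D.r (x, y)).2) = fun x => (lam (D.val x) v)⁻¹ • x := by
    funext x
    rw [r_eq]
  rw [h, Function.bijective_iff_has_inverse]
  refine ⟨fun z => ((lam v (D.val z)⁻¹)⁻¹ * v * (D.val z)⁻¹) • z, fun x => ?_, fun z => ?_⟩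
  · set u := D.val x with hu
    have h1 : lam v (lam (lam u v)⁻¹ u)⁻¹ = u⁻¹ := by
      have h2 := mul_lam_inv u⁻¹ v
      rw [inv_inv] at h2
      rw [lam_inv_self, mul_inv_rev, inv_inv, mul_inv_rev, lam, mul_assoc, mul_inv_cancel_left, h2]
      abel
    simp only [D.val_smul, ← hu, h1, smul_smul]
    rw [lam_inv_self]
    convert one_smul B x using 2
    group
  · set q := D.val z with hq
    set u := (lam v q⁻¹)⁻¹ with hu
    have h1 : u * v * q⁻¹ = lam u v := by
      have h2 : v * q⁻¹ = v + u⁻¹ := by rw [hu, inv_inv, add_lam]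
      have h3 := mul_add_add u v u⁻¹
      rw [mul_inv_cancel, one_eq_zero, add_zero] at h3
      rw [mul_assoc, h2, lam, ← h3]
      abel
    have h4 : lam (lam u v) q = u := by
      rw [← h1, lam, inv_mul_cancel_right, h1, ← add_lam]
      abel
    change (lam (D.val ((u * v * q⁻¹) • z)) v)⁻¹ • (u * v * q⁻¹) • z = z
    rw [D.val_smul, ← hq, h1, h4, inv_smul_smul]

/-- The constructed pair `(X, r)` is a solution (it has only to be assumed that `X` is not empty,
which can fail only if `I = ∅` and `B = {1}`). -/
theorem isSolution_r [hX : Nonempty D.X] : IsSolution D.r := by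
  refine ⟨hX, Function.Involutive.bijective (congrFun D.isInvolutive_r), ?_⟩
  funext ⟨x, y, z⟩
  simp only [Function.comp_apply, leftMap, rightMap, r_eq, D.val_smul]
  generalize D.val x = u
  generalize D.val y = v
  generalize D.val z = w
  have h1 : lam (lam u v) (lam (lam (lam u v)⁻¹ u) w) = lam u (lam v w) := by
    rw [← lam_mul, lam_inv_self, mul_inv_cancel_left, lam_mul]
  have h2 : lam u v * lam (lam (lam u v)⁻¹ u) w = lam u v + lam u (lam v w) := by
    rw [← h1, add_lam]
  have h3 : lam u (lam v w) * lam (lam (lam u (lam v w))⁻¹ u) (lam (lam v w)⁻¹ v) =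
      lam u v + lam u (lam v w) := by
    have h4 := lam_inv_self u (lam v w)
    rw [h4]
    generalize lam u (lam v w) = A
    generalize lam v w = s
    rw [lam_mul, lam_mul, ← lam_mul s, mul_inv_cancel, lam_one, mul_lam_inv, add_comm]
  refine Prod.ext ?_ (Prod.ext ?_ ?_)
  · simp only [smul_smul]
    rw [lam_inv_self, mul_inv_cancel_left]
  · simp only [smul_smul]
    rw [h1, lam_inv_self, mul_assoc, mul_inv_cancel_right]
  · simp only [smul_smul, ← mul_inv_rev]
    rw [h2, h3]

end InvolutiveDatum

/-! ### Generators and homomorphisms of left braces -/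

namespace LeftBrace

variable {B : Type*} [LeftBrace B]

/-! With `val` as the map b K ↦ λ_b(a_i), f_x is the action of `val x`, and the first component of
the isomorphism equation reads F(`val x` • y) = `val (F x)` • F y. The values of `val` form a
λ-invariant set generating (B, +), hence also (B, ·). So F carries the action of every b to that of
some ψ(b), and faithfulness (the trivial intersection of cores) makes ψ an automorphism of (B, ·)
with ψ(`val x`) = `val (F x)`. Equivariance of `val` makes ψ compatible with λ on additive
generators, so ψ is additive because b + c = b · λ_{b⁻¹}(c) (`exists_ringEquiv`).

Now F permutes B-orbits, which are indexed by the pairs (i, j), and i is read off from the λ-orbit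
of `val`; this yields α and β. Writing F(K) = z L, comparison of values and of stabilisers gives the
two conditions. Conversely, they make b K ↦ ψ(b) z L a well-defined equivariant bijection compatible
with `val`, hence an isomorphism. -/

theorem lam_zero (a : B) : lam a 0 = 0 := by
  rw [lam, ← one_eq_zero, mul_one, one_eq_zero, neg_add_cancel]

theorem lam_neg (a b : B) : lam a (-b) = -lam a b := by
  rw [eq_neg_iff_add_eq_zero, ← lam_add, neg_add_cancel, lam_zero]

theorem mul_lam_inv_self (a : B) : a⁻¹ = -lam a⁻¹ a := by
  rw [lam, inv_mul_cancel, one_eq_zero, add_zero, neg_neg]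

/-- The negative of an element is the inverse of an element of its orbit. -/
theorem neg_eq_inv_lam (s : B) : -s = (lam (-s)⁻¹ s)⁻¹ := by
  have h := mul_lam_inv_self (-s)
  rw [lam_neg, neg_neg] at h
  rw [← h, inv_inv]

/-- A `λ`-invariant set generating the additive group generates the multiplicative group. -/
theorem closure_eq_top_of_lam_mem {S : Set B} (hS : ∀ b, ∀ s ∈ S, lam b s ∈ S)
    (h : AddSubgroup.closure S = ⊤) : Subgroup.closure S = ⊤ := by
  rw [eq_top_iff]
  intro b _
  have hb : b ∈ AddSubgroup.closure S := by rw [h]; trivial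
  induction hb using AddSubgroup.closure_induction_right with
  | zero => rw [← one_eq_zero]; exact one_mem _
  | add_right x _ s hs ih =>
    rw [← mul_lam_inv]
    exact mul_mem (ih trivial) (Subgroup.subset_closure (hS _ _ hs))
  | add_neg_cancel x _ s hs ih =>
    -- x - s is x times the inverse of an element obtained from s by applying λ twice.
    rw [← mul_lam_inv, lam_neg, neg_eq_inv_lam]
    exact mul_mem (ih trivial) (inv_mem (Subgroup.subset_closure (hS _ _ (hS _ _ hs))))

/-- A multiplicative isomorphism which is compatible with `λ` on a set of additive generators is additive. -/
theorem map_add_of_closure_eq_top {C : Type*} [LeftBrace C] {S : Set B}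
    (h : AddSubgroup.closure S = ⊤) (ψ : B ≃* C)
    (hψ : ∀ b, ∀ s ∈ S, ψ (lam b s) = lam (ψ b) (ψ s)) (b c : B) :
    ψ (b + c) = ψ b + ψ c := by
  have h0 : ψ 0 = 0 := by rw [← one_eq_zero, map_one, one_eq_zero]
  have hc : c ∈ AddSubgroup.closure S := by rw [h]; trivial
  induction hc using AddSubgroup.closure_induction generalizing b with
  | mem s hs => rw [← mul_lam_inv, map_mul, hψ _ _ hs, map_inv, mul_lam_inv]
  | zero => rw [h0, add_zero, add_zero]
  | add x y _ _ hx hy => rw [← add_assoc, hy, hx, hy, add_assoc]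
  | neg x _ hx =>
    -- The induction hypothesis, available for every left summand, is used at b - x and at -x.
    have h1 := hx (b + -x)
    have h2 := hx (-x)
    rw [neg_add_cancel_right] at h1
    rw [neg_add_cancel, h0] at h2
    rw [h1, eq_neg_of_add_eq_zero_left h2.symm, add_neg_cancel_right]

theorem map_lam {C : Type*} [LeftBrace C] (ψ : B ≃+* C) (b c : B) :
    ψ (lam b c) = lam (ψ b) (ψ c) := by
  have h : ψ (-b) = -ψ b := map_neg ψ.toAddEquiv b
  rw [lam, map_add, map_mul, h, lam]

theorem mem_orbit_self (b : B) : b ∈ orbit b := ⟨1, lam_one b⟩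

theorem orbit_eq_of_mem {b c : B} (h : c ∈ orbit b) : orbit c = orbit b := by
  obtain ⟨d, rfl⟩ := h
  refine Set.Subset.antisymm ?_ ?_
  · rintro _ ⟨e, rfl⟩
    exact ⟨e * d, lam_mul e d b⟩
  · rintro _ ⟨e, rfl⟩
    refine ⟨e * d⁻¹, ?_⟩
    change lam (e * d⁻¹) (lam d b) = lam e b
    rw [← lam_mul, inv_mul_cancel_right]

theorem orbits_eq_orbit {i : orbits B} {b : B} (h : b ∈ (i : Set B)) : (i : Set B) = orbit b := by
  obtain ⟨_, c, rfl⟩ := i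
  exact (orbit_eq_of_mem h).symm

end LeftBrace

/-! ### Bijections of disjoint unions -/

/-- A bijection of total spaces which preserves and reflects being in the same fibre comes from
bijections of the bases and of the fibres. -/
theorem Equiv.exists_sigma_of_fst_eq_iff {ι ι' : Type*} {J : ι → Type*} {J' : ι' → Type*}
    [∀ i, Nonempty (J i)] [∀ i, Nonempty (J' i)] (e : (Σ i, J i) ≃ Σ i, J' i)
    (he : ∀ p q, (e p).1 = (e q).1 ↔ p.1 = q.1) :
    ∃ (α : ι ≃ ι') (β : ∀ i, J i ≃ J' (α i)), ∀ i j, e ⟨i, j⟩ = ⟨α i, β i j⟩ := by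
  -- The choice of point in the fibre is immaterial, since `e` preserves fibres.
  let α₀ : ι → ι' := fun i => (e ⟨i, Classical.arbitrary _⟩).1
  have h1 : ∀ i j, (e ⟨i, j⟩).1 = α₀ i := fun i j => (he _ _).2 rfl
  have hα : Function.Bijective α₀ := by
    refine ⟨fun i k h => (he _ _).1 h, fun i' => ?_⟩
    obtain ⟨⟨i, j⟩, h⟩ := e.surjective ⟨i', Classical.arbitrary _⟩
    exact ⟨i, by rw [← h1 i j, h]⟩
  have h2 : ∀ i j, ∃ j', e ⟨i, j⟩ = ⟨α₀ i, j'⟩ := fun i j => by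
    rw [← h1 i j]
    exact ⟨_, rfl⟩
  choose β₀ hβ₀ using h2
  have hβ : ∀ i, Function.Bijective (β₀ i) := by
    refine fun i => ⟨fun j k h => ?_, fun j' => ?_⟩
    · have : e ⟨i, j⟩ = e ⟨i, k⟩ := by rw [hβ₀, hβ₀, h]
      simpa using e.injective this
    · obtain ⟨⟨k, j⟩, h⟩ := e.surjective ⟨α₀ i, j'⟩
      obtain rfl : k = i := hα.1 (by rw [← h1 k j, h])
      rw [hβ₀] at h
      exact ⟨j, by simpa using h⟩
  exact ⟨Equiv.ofBijective α₀ hα, fun i => Equiv.ofBijective _ (hβ i), hβ₀⟩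

/-! ### Cosets, indices and values -/

namespace InvolutiveDatum

open LeftBrace

variable {B : Type*} [LeftBrace B] {a : orbits B → B} (D D' : InvolutiveDatum B a)

theorem exists_coset (x : D.X) : ∃ b i j, x = D.coset b i j := by
  obtain ⟨i, j, q⟩ := x
  induction q using Quotient.inductionOn' with
  | h b => exact ⟨b, i, j, rfl⟩

/-- The index `(i, j)` of a coset of `K i j`. -/
def index (x : D.X) : Σ i : D.I, D.J i := ⟨x.1, x.2.1⟩

theorem index_coset (b : B) (i : D.I) (j : D.J i) : D.index (D.coset b i j) = ⟨i, j⟩ := rfl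

theorem coset_eq_coset_iff (b c : B) (i : D.I) (j : D.J i) :
    D.coset b i j = D.coset c i j ↔ b⁻¹ * c ∈ D.K i j := by
  rw [← QuotientGroup.eq]
  refine ⟨fun h => ?_, fun h => ?_⟩
  · have h1 := eq_of_heq (Sigma.mk.inj h).2
    exact eq_of_heq (Sigma.mk.inj h1).2
  · unfold coset
    rw [h]

theorem exists_eq_coset_of_index_eq {x : D.X} {i : D.I} {j : D.J i} (h : D.index x = ⟨i, j⟩) :
    ∃ b, x = D.coset b i j := by
  obtain ⟨b, i', j', rfl⟩ := D.exists_coset x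
  rw [index_coset] at h
  cases h
  exact ⟨b, rfl⟩

/-- Left multiplication is transitive on each B / K, so the indices label the B-orbits of X. -/
theorem index_eq_iff (x y : D.X) : D.index x = D.index y ↔ ∃ b : B, b • x = y := by
  refine ⟨fun h => ?_, ?_⟩
  · obtain ⟨c, i, j, rfl⟩ := D.exists_coset y
    obtain ⟨b, rfl⟩ := D.exists_eq_coset_of_index_eq h
    exact ⟨c * b⁻¹, by rw [smul_coset, inv_mul_cancel_right]; rfl⟩
  · rintro ⟨b, rfl⟩
    rfl

variable {D D'}

theorem val_mem (ha : ∀ i : orbits B, a i ∈ (i : Set B)) (x : D.X) :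
    D.val x ∈ ((D.index x).1 : Set B) := by
  obtain ⟨b, i, j, rfl⟩ := D.exists_coset x
  rw [val_coset, index_coset, orbits_eq_orbit (ha i)]
  exact ⟨b, rfl⟩

/-- The value of a coset with index (i, j) lies in the λ-orbit i, so `val` determines i. -/
theorem index_fst_eq_iff (ha : ∀ i : orbits B, a i ∈ (i : Set B)) (x y : D.X) :
    (D.index x).1 = (D.index y).1 ↔ ∃ b, lam b (D.val x) = D.val y := by
  have hx := orbits_eq_orbit (val_mem ha x)
  have hy := orbits_eq_orbit (val_mem ha y)
  rw [← Subtype.coe_inj, ← Subtype.coe_inj, hx, hy]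
  refine ⟨fun h => ?_, fun h => (orbit_eq_of_mem h).symm⟩
  have := mem_orbit_self (D.val y)
  rwa [← h] at this

variable (D) in
theorem lam_mem_range_val (b s : B) (hs : s ∈ Set.range D.val) : lam b s ∈ Set.range D.val := by
  obtain ⟨x, rfl⟩ := hs
  exact ⟨b • x, D.val_smul b x⟩

theorem addSubgroup_closure_range_val (ha : ∀ i : orbits B, a i ∈ (i : Set B)) :
    AddSubgroup.closure (Set.range D.val) = ⊤ := by
  rw [eq_top_iff, ← D.closure_eq_top]
  refine AddSubgroup.closure_mono (Set.iUnion₂_subset fun i hi => ?_)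
  obtain ⟨j⟩ := D.nonempty_J ⟨i, hi⟩
  rw [orbits_eq_orbit (ha i)]
  rintro _ ⟨b, rfl⟩
  exact ⟨D.coset b ⟨i, hi⟩ j, rfl⟩

theorem closure_range_val (ha : ∀ i : orbits B, a i ∈ (i : Set B)) :
    Subgroup.closure (Set.range D.val) = ⊤ :=
  closure_eq_top_of_lam_mem D.lam_mem_range_val (addSubgroup_closure_range_val ha)

theorem smul_coset_eq_self_iff (c b : B) (i : D.I) (j : D.J i) :
    c • D.coset b i j = D.coset b i j ↔ b⁻¹ * c * b ∈ D.K i j := by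
  rw [eq_comm, smul_coset, coset_eq_coset_iff, mul_assoc]

-- The kernel of the action on X is the intersection of the cores of all K.
variable (D) in
instance : FaithfulSMul B D.X := by
  refine ⟨fun {b c} h => ?_⟩
  rw [← inv_mul_eq_one, ← Subgroup.mem_bot, ← D.iInf_core]
  simp only [Subgroup.mem_iInf]
  intro i j g
  -- The stabiliser of g⁻¹K is g⁻¹Kg, which matches the conjugation by g in the core.
  have h1 : (b⁻¹ * c) • D.coset g⁻¹ i j = D.coset g⁻¹ i j := by
    rw [mul_smul, ← h, inv_smul_smul]
  simpa using (smul_coset_eq_self_iff _ _ _ _).1 h1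

/-! ### From isomorphisms to brace automorphisms -/

theorem areIsomorphic_iff :
    AreIsomorphic D.r D'.r ↔ ∃ F : D.X ≃ D'.X,
      (∀ x y, F (D.val x • y) = D'.val (F x) • F y) ∧
      ∀ x y, F ((lam (D.val x) (D.val y))⁻¹ • x) = (lam (D'.val (F x)) (D'.val (F y)))⁻¹ • F x := by
  constructor
  · rintro ⟨F, hF, h⟩
    refine ⟨Equiv.ofBijective F hF, fun x y => ?_, fun x y => ?_⟩
    · have := congrArg Prod.fst (h x y)
      rw [r_eq, r_eq] at this
      exact this.symm
    · have := congrArg Prod.snd (h x y)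
      rw [r_eq, r_eq] at this
      exact this.symm
  · rintro ⟨F, h1, h2⟩
    refine ⟨F, F.bijective, fun x y => ?_⟩
    rw [r_eq, r_eq]
    exact Prod.ext (h1 x y).symm (h2 x y).symm

/-- The elements b admitting such a c form a subgroup, and it contains the values of `val`, which
generate (B, ·). -/
theorem exists_map_smul (ha : ∀ i : orbits B, a i ∈ (i : Set B)) (F : D.X ≃ D'.X)
    (hF : ∀ x y, F (D.val x • y) = D'.val (F x) • F y) (b : B) :
    ∃ c : B, ∀ x, F (b • x) = c • F x := by
  have hb : b ∈ Subgroup.closure (Set.range D.val) := by rw [closure_range_val ha]; trivial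
  induction hb using Subgroup.closure_induction with
  | mem s hs =>
    obtain ⟨x, rfl⟩ := hs
    exact ⟨_, hF x⟩
  | one => exact ⟨1, fun x => by rw [one_smul, one_smul]⟩
  | mul b c _ _ hb hc =>
    obtain ⟨b', hb⟩ := hb
    obtain ⟨c', hc⟩ := hc
    exact ⟨b' * c', fun x => by rw [mul_smul, mul_smul, hb, hc]⟩
  | inv b _ hb =>
    obtain ⟨b', hb⟩ := hb
    exact ⟨b'⁻¹, fun x => by rw [eq_inv_smul_iff, ← hb, smul_inv_smul]⟩

/-- Faithfulness makes the element matching b unique, hence multiplicative in b; the same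
construction for F⁻¹ supplies the inverse. -/
theorem exists_mulEquiv (ha : ∀ i : orbits B, a i ∈ (i : Set B)) (F : D.X ≃ D'.X)
    (hF : ∀ x y, F (D.val x • y) = D'.val (F x) • F y) :
    ∃ ψ : B ≃* B, ∀ b x, F (b • x) = ψ b • F x := by
  have hF' : ∀ x y, F.symm (D'.val x • y) = D.val (F.symm x) • F.symm y := fun x y => by
    rw [Equiv.symm_apply_eq, hF, F.apply_symm_apply, F.apply_symm_apply]
  choose ψ hψ using exists_map_smul ha F hF
  choose φ hφ using exists_map_smul ha F.symm hF'
  refine ⟨⟨⟨ψ, φ, fun b => ?_, fun b => ?_⟩, fun b c => ?_⟩, hψ⟩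
  · refine FaithfulSMul.eq_of_smul_eq_smul (α := D.X) fun x => ?_
    have := hφ (ψ b) (F x)
    rwa [← hψ, F.symm_apply_apply, F.symm_apply_apply, eq_comm] at this
  · refine FaithfulSMul.eq_of_smul_eq_smul (α := D'.X) fun x => ?_
    have := hψ (φ b) (F.symm x)
    rwa [← hφ, F.apply_symm_apply, F.apply_symm_apply, eq_comm] at this
  · refine FaithfulSMul.eq_of_smul_eq_smul (α := D'.X) fun x => ?_
    obtain ⟨y, rfl⟩ := F.surjective x
    change ψ (b * c) • F y = (ψ b * ψ c) • F y
    rw [← hψ, mul_smul, mul_smul, hψ, hψ]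

/-- A bijection compatible with the maps `f_x` is equivariant along an automorphism of the brace,
which is compatible with `val`. -/
theorem exists_ringEquiv (ha : ∀ i : orbits B, a i ∈ (i : Set B)) (F : D.X ≃ D'.X)
    (hF : ∀ x y, F (D.val x • y) = D'.val (F x) • F y) :
    ∃ ψ : B ≃+* B, (∀ b x, F (b • x) = ψ b • F x) ∧ ∀ x, ψ (D.val x) = D'.val (F x) := by
  obtain ⟨ψ, hψ⟩ := exists_mulEquiv ha F hF
  have hval : ∀ x, ψ (D.val x) = D'.val (F x) := fun x => by
    refine FaithfulSMul.eq_of_smul_eq_smul (α := D'.X) fun y => ?_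
    obtain ⟨y, rfl⟩ := F.surjective y
    rw [← hψ, hF]
  refine ⟨⟨ψ.toEquiv, map_mul ψ, map_add_of_closure_eq_top
    (addSubgroup_closure_range_val (D := D) ha) ψ ?_⟩, hψ, hval⟩
  -- On a generator s = `val x`, compatibility with λ follows from λ_b(s) = `val (b • x)`.
  rintro b _ ⟨x, rfl⟩
  rw [← val_smul, hval, hval, hψ, val_smul]

/-! ### Equivariant bijections between the coset spaces -/

/-- An equivariant bijection induces a bijection of the sets of indices. -/
theorem exists_index_equiv (F : D.X ≃ D'.X) (ψ : B ≃+* B)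
    (hψ : ∀ b x, F (b • x) = ψ b • F x) :
    ∃ e : (Σ i, D.J i) ≃ Σ i, D'.J i, ∀ x, D'.index (F x) = e (D.index x) := by
  have hF : ∀ x y, D'.index (F x) = D'.index (F y) ↔ D.index x = D.index y := fun x y => by
    rw [index_eq_iff, index_eq_iff, ψ.surjective.exists (p := fun b => b • F x = F y)]
    simp only [← hψ, F.apply_eq_iff_eq]
  let e : (Σ i, D.J i) → Σ i, D'.J i := fun p => D'.index (F (D.coset 1 p.1 p.2))
  have he : ∀ x, D'.index (F x) = e (D.index x) := fun x => (hF _ _).2 rfl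
  refine ⟨Equiv.ofBijective e ⟨fun p q h => (hF _ _).1 h, fun p => ?_⟩, he⟩
  obtain ⟨x, hx⟩ := F.surjective (D'.coset 1 p.1 p.2)
  exact ⟨D.index x, by rw [← he, hx]; rfl⟩

/-- The equivariant map sending `b K i j` to `ψ b z L`, for `ψ (K i j) = z L z⁻¹`. -/
theorem exists_equivariant_equiv (ψ : B ≃+* B) (α : D.I ≃ D'.I) (β : ∀ i, D.J i ≃ D'.J (α i))
    (z : ∀ i : D.I, D.J i → B)
    (h : ∀ i j b, b ∈ D.K i j ↔ (z i j)⁻¹ * ψ b * z i j ∈ D'.K (α i) (β i j)) :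
    ∃ F : D.X ≃ D'.X, ∀ b i j, F (D.coset b i j) = D'.coset (ψ b * z i j) (α i) (β i j) := by
  have key : ∀ i j b c, D.coset b i j = D.coset c i j ↔
      D'.coset (ψ b * z i j) (α i) (β i j) = D'.coset (ψ c * z i j) (α i) (β i j) := by
    intro i j b c
    have hi : ψ b⁻¹ = (ψ b)⁻¹ := map_inv ψ.toMulEquiv b
    rw [coset_eq_coset_iff, coset_eq_coset_iff, h, map_mul, hi, mul_inv_rev]
    simp only [mul_assoc]
  let F : D.X → D'.X := fun x => Quotient.liftOn' x.2.2
    (fun b => D'.coset (ψ b * z x.1 x.2.1) (α x.1) (β x.1 x.2.1)) fun b c hbc =>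
      (key _ _ _ _).1 ((D.coset_eq_coset_iff _ _ _ _).2 (QuotientGroup.leftRel_apply.mp hbc))
  have hF : ∀ b i j, F (D.coset b i j) = D'.coset (ψ b * z i j) (α i) (β i j) :=
    fun _ _ _ => rfl
  refine ⟨Equiv.ofBijective F ⟨fun x y hxy => ?_, fun y => ?_⟩, hF⟩
  · obtain ⟨b, i, j, rfl⟩ := D.exists_coset x
    obtain ⟨c, k, l, rfl⟩ := D.exists_coset y
    have hi := congrArg D'.index hxy
    rw [hF, hF, index_coset, index_coset] at hi
    obtain rfl : i = k := α.injective (congrArg Sigma.fst hi)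
    obtain rfl : j = l := (β i).injective (eq_of_heq (Sigma.mk.inj hi).2)
    rw [hF, hF] at hxy
    exact (key _ _ _ _).2 hxy
  · obtain ⟨c, i', j', rfl⟩ := D'.exists_coset y
    obtain ⟨i, rfl⟩ := α.surjective i'
    obtain ⟨j, rfl⟩ := (β i).surjective j'
    -- Solves ψ(b) z = c.
    obtain ⟨b, hb⟩ := ψ.surjective (c * (z i j)⁻¹)
    exact ⟨D.coset b i j, by rw [hF, hb, inv_mul_cancel_right]⟩

theorem image_eq_conj_image_iff {G H : Type*} [Group H] (ψ : G ≃ H) (K : Set G) (L : Set H)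
    (z : H) : ψ '' K = (fun l => z * l * z⁻¹) '' L ↔ ∀ b, b ∈ K ↔ z⁻¹ * ψ b * z ∈ L := by
  have hL : ∀ c, c ∈ (fun l => z * l * z⁻¹) '' L ↔ z⁻¹ * c * z ∈ L := by
    intro c
    constructor
    · rintro ⟨l, hl, rfl⟩
      simpa [mul_assoc] using hl
    · exact fun h => ⟨_, h, by simp [mul_assoc]⟩
  rw [Set.ext_iff, ← ψ.forall_congr_right]
  simp only [hL, ψ.injective.mem_set_image]

end InvolutiveDatum

/-! ### The isomorphism criterion -/

open LeftBrace InvolutiveDatum in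
theorem mainTheorem5 {B : Type*} [LeftBrace B] (a : LeftBrace.orbits B → B)
    (ha : ∀ i : LeftBrace.orbits B, a i ∈ (i : Set B)) (D D' : InvolutiveDatum B a) :
    AreIsomorphic D.r D'.r ↔
      ∃ (ψ : B ≃+* B) (α : D.I ≃ D'.I) (β : ∀ i : D.I, D.J i ≃ D'.J (α i))
        (z : ∀ i : D.I, D.J i → B),
        ∀ (i : D.I) (j : D.J i),
          ψ (a i) = LeftBrace.lam (z i j) (a (α i)) ∧
          ψ '' (D.K i j : Set B) =
            (fun l => z i j * l * (z i j)⁻¹) '' (D'.K (α i) (β i j) : Set B) := by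
  rw [areIsomorphic_iff]
  constructor
  · rintro ⟨F, hF, -⟩
    obtain ⟨ψ, hψ, hval⟩ := exists_ringEquiv ha F hF
    obtain ⟨e, he⟩ := exists_index_equiv F ψ hψ
    have := D.nonempty_J
    have := D'.nonempty_J
    obtain ⟨α, β, hαβ⟩ := e.exists_sigma_of_fst_eq_iff fun p q => by
      have hp := he (D.coset 1 p.1 p.2)
      have hq := he (D.coset 1 q.1 q.2)
      rw [index_coset] at hp hq
      -- ψ commutes with λ, so values lie in one λ-orbit before applying F exactly when they do
      -- after.
      rw [← hp, ← hq, index_fst_eq_iff ha, ψ.surjective.exists (p := fun b =>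
        lam b (D'.val (F (D.coset 1 p.1 p.2))) = D'.val (F (D.coset 1 q.1 q.2)))]
      simp only [← hval, ← map_lam, ψ.injective.eq_iff]
      rw [← index_fst_eq_iff ha]
      rfl
    have hz : ∀ i j, ∃ z, F (D.coset 1 i j) = D'.coset z (α i) (β i j) := fun i j =>
      D'.exists_eq_coset_of_index_eq (by rw [he, index_coset, hαβ])
    choose z hz using hz
    refine ⟨ψ, α, β, z, fun i j => ⟨?_, (image_eq_conj_image_iff ψ.toEquiv _ _ _).2 fun b => ?_⟩⟩
    · have := hval (D.coset 1 i j)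
      rwa [hz, val_coset, val_coset, lam_one] at this
    · change b ∈ D.K i j ↔ (z i j)⁻¹ * ψ b * z i j ∈ D'.K (α i) (β i j)
      -- ψ maps the stabiliser K of the coset K onto the stabiliser z L z⁻¹ of its image z L.
      rw [← smul_coset_eq_self_iff, ← hz, ← hψ, F.apply_eq_iff_eq, smul_coset_eq_self_iff,
        inv_one, one_mul, mul_one]
  · rintro ⟨ψ, α, β, z, h⟩
    obtain ⟨F, hF⟩ := exists_equivariant_equiv ψ α β z fun i j =>
      (image_eq_conj_image_iff ψ.toEquiv _ _ _).1 (h i j).2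
    have hψ : ∀ b x, F (b • x) = ψ b • F x := fun b x => by
      obtain ⟨c, i, j, rfl⟩ := D.exists_coset x
      rw [smul_coset, hF, hF, smul_coset, map_mul, mul_assoc]
    have hval : ∀ x, D'.val (F x) = ψ (D.val x) := fun x => by
      obtain ⟨c, i, j, rfl⟩ := D.exists_coset x
      rw [hF, val_coset, val_coset, map_lam, (h i j).1, lam_mul]
    refine ⟨F, fun x y => by rw [hψ, hval], fun x y => ?_⟩
    have hi : ∀ b, ψ b⁻¹ = (ψ b)⁻¹ := map_inv ψ.toMulEquiv
    rw [hψ, hi, map_lam, hval, hval]
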